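/- Consider $n$ qubits with the Majorana operators $\gamma_{2j-1}=\big(\prod_{k<j}Z_k\big)X_j$, $\gamma_{2j}=\big(\prod_{k<j}Z_k\big)Y_j$ ($1\le j\le n$). For a state $\rho$ let $(\Gamma_\rho)_{ab}=-\tfrac{i}{2}\operatorname{tr}(\rho[\gamma_a,\gamma_b])$ be its real $2n\times 2n$ covariance matrix and $\operatorname{FAF}_1(\rho)=n-\tfrac12\operatorname{tr}(-\Gamma_\rho^2)$. Write $\operatorname{FAF}_1(\psi)=\operatorname{FAF}_1(|\psi\rangle\langle\psi|)$ for a unit vector $\psi$. Let $\mathcal G_n$ be the set of pure fermionic Gaussian states, i.e. of unit vectors $\phi$ with $\Gamma_{|\phi\rangle\langle\phi|}^2=-I_{2n}$, and let $\epsilon_G(\psi)=\inf_{\phi\in\mathcal G_n}\tfrac12\big\||\psi\rangle\langle\psi|-|\phi\rangle\langle\phi|\big\|_1$. (1) Let $n\ge4$ be even. For every real $\epsilon$ with $0\le\epsilon\le 1/\sqrt2$, the unit vector $\psi_{n,\epsilon}=\sqrt{1-\epsilon^2}\,|0\rangle^{\otimes n}+\epsilon\,|1\rangle^{\otimes n}$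 satisfies $\epsilon_G(\psi_{n,\epsilon})=\epsilon$, the infimum being attained, and $\operatorname{FAF}_1(\psi_{n,\epsilon})=4n\epsilon^2(1-\epsilon^2)$. (2) Consequently the factor $1/(4n)$ in the inequality $\tfrac1{4n}\operatorname{FAF}_1(\psi)\le\epsilon_G(\psi)^2$ is essentially tight: for every even $n\ge4$, $\operatorname{FAF}_1(\psi_{n,\epsilon})/(n\,\epsilon_G(\psi_{n,\epsilon})^2)\to4$ as $\epsilon\downarrow0$; for every even $n\ge4$, if $c\in\mathbb R$ is such that $\tfrac cn\operatorname{FAF}_1(\psi)\le\epsilon_G(\psi)^2$ for all pure states $\psi$ of $n$ qubits, then $c\le\tfrac14$; and there is no $c>0$ such that $c\operatorname{FAF}_1(\psi)\le\epsilon_G(\psi)^2$ for all $n\ge1$ and all pure states $\psi$ of $n$ qubits. (3) For every $n\ge4$, the unit vector $\psi_n=\tfrac1{\sqrt2}(|0000\rangle+|1111\rangle)\otimes|0\rangle^{\otimes(n-4)}$ satisfies $\operatorname{FAF}_1(\psi_n)=4$ and $\epsilon_G(\psi_n)^2=\tfrac12$, the infimum in $\epsilon_G(\psi_n)$ being attained.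 Consequently there is no constant $C\in\mathbb R$ such that $\epsilon_G(\psi)^2\le C\operatorname{FAF}_1(\psi)/n$ for all $n\ge1$ and all pure states $\psi$ of $n$ qubits. -/

import Mathlib

open scoped Topology Matrix

noncomputable section

namespace FAF

/-- The state space of `n` qubits (equivalently, `n` fermionic modes): square-summable amplitudes on
the occupation strings `x : Fin n → Fin 2`. -/
abbrev State (n : ℕ) : Type := EuclideanSpace ℂ (Fin n → Fin 2)

/-- Operators on `n` qubits, as matrices in the occupation basis. -/
abbrev Op (n : ℕ) : Type := Matrix (Fin n → Fin 2) (Fin n → Fin 2) ℂ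

/-- The occupation basis vector `|x₁ … xₙ⟩`. -/
def ket {n : ℕ} (x : Fin n → Fin 2) : State n := EuclideanSpace.single x 1

/-- The product `|u⟩ ⊗ |v⟩` of an `m`-qubit state and a `k`-qubit state. -/
def tensorState {m k : ℕ} (u : State m) (v : State k) : State (m + k) :=
  WithLp.toLp 2 fun x => u (fun i => x (Fin.castAdd k i)) * v (fun j => x (Fin.natAdd m j))

/-- The density operator `|ψ⟩⟨ψ|`. -/
def density {n : ℕ} (ψ : State n) : Op n := Matrix.of fun x y => ψ x * star (ψ y)

/-- The Pauli matrices. -/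
def pauliX : Matrix (Fin 2) (Fin 2) ℂ := !![0, 1; 1, 0]

def pauliY : Matrix (Fin 2) (Fin 2) ℂ := !![0, -Complex.I; Complex.I, 0]

def pauliZ : Matrix (Fin 2) (Fin 2) ℂ := !![1, 0; 0, -1]

/-- The operator `A₁ ⊗ ⋯ ⊗ Aₙ` on `n` qubits. -/
def tensorOp {n : ℕ} (A : Fin n → Matrix (Fin 2) (Fin 2) ℂ) : Op n :=
  Matrix.of fun x y => ∏ j, A j (x j) (y j)

/-- The `2n` Majorana operators in the Jordan–Wigner representation. The index `(j, 0)` stands for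
`γ_{2j-1} = (∏_{k<j} Z_k) X_j` and `(j, 1)` for `γ_{2j} = (∏_{k<j} Z_k) Y_j`. -/
def majorana {n : ℕ} (a : Fin n × Fin 2) : Op n :=
  tensorOp fun k =>
    if k < a.1 then pauliZ else if k = a.1 then (if a.2 = 0 then pauliX else pauliY) else 1

/-- The complex number `-(i/2) tr(ρ [γ_a, γ_b])`; it is real for Hermitian `ρ`
(see `covarianceEntry_im`). -/
def covarianceEntry {n : ℕ} (ρ : Op n) (a b : Fin n × Fin 2) : ℂ :=
  -Complex.I * (1 / 2) *
    Matrix.trace (ρ * (majorana a * majorana b - majorana b * majorana a))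

/-- The real covariance matrix `(Γ_ρ)_{ab} = -(i/2) tr(ρ [γ_a, γ_b])`. -/
def covariance {n : ℕ} (ρ : Op n) : Matrix (Fin n × Fin 2) (Fin n × Fin 2) ℝ :=
  Matrix.of fun a b => (covarianceEntry ρ a b).re

/-- The `k`-th order fermionic antiflatness `FAF_k(ρ) = n - ½ tr[(-Γ_ρ²)^k]`. -/
def faf {n : ℕ} (k : ℕ) (ρ : Op n) : ℝ :=
  n - (1 / 2) * Matrix.trace ((-(covariance ρ ^ 2)) ^ k)

/-- The set `𝒢_n` of pure fermionic Gaussian states: unit vectors whose covariance matrix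
satisfies `Γ² = -I`. -/
def pureGaussian (n : ℕ) : Set (State n) :=
  {φ | ‖φ‖ = 1 ∧ covariance (density φ) ^ 2 = -1}

/-- The trace norm `‖A‖₁`, the sum of the singular values of `A`. -/
def traceNorm {n : ℕ} (A : Op n) : ℝ :=
  ∑ i, √((Matrix.isHermitian_conjTranspose_mul_self A).eigenvalues i)

/-- The trace distance `½ ‖ρ - σ‖₁`. -/
def traceDist {n : ℕ} (ρ σ : Op n) : ℝ := (1 / 2) * traceNorm (ρ - σ)

/-- The trace distances from `ψ` to the pure Gaussian states. -/
def gaussianDistances {n : ℕ} (ψ : State n) : Set ℝ :=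
  (fun φ => traceDist (density ψ) (density φ)) '' pureGaussian n

/-- The distance `ε_G(ψ)` of `ψ` to the closest pure Gaussian state. -/
def epsG {n : ℕ} (ψ : State n) : ℝ := sInf (gaussianDistances ψ)

/-- The cat state `√(1-ε²) |0…0⟩ + ε |1…1⟩`. -/
def catState (n : ℕ) (ε : ℝ) : State n :=
  ((√(1 - ε ^ 2) : ℝ) : ℂ) • ket (fun _ => 0) + (ε : ℂ) • ket (fun _ => 1)

/-- The localized defect `(|0000⟩ + |1111⟩)/√2 ⊗ |0⟩^{⊗m}` on `4 + m` modes. -/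
def defectState (m : ℕ) : State (4 + m) :=
  tensorState (((1 / √2 : ℝ) : ℂ) • (ket (fun _ : Fin 4 => 0) + ket (fun _ : Fin 4 => 1)))
    (ket (fun _ : Fin m => 0))

theorem majorana_conjTranspose {n : ℕ} (a : Fin n × Fin 2) : (majorana a)ᴴ = majorana a := by
  ext x y
  simp only [majorana, tensorOp, Matrix.conjTranspose_apply, Matrix.of_apply, star_prod]
  refine Finset.prod_congr rfl fun k _ => ?_
  generalize x k = s
  generalize y k = t
  split_ifs <;> fin_cases s <;> fin_cases t <;> simp [pauliX, pauliY, pauliZ]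

theorem covarianceEntry_im {n : ℕ} {ρ : Op n} (hρ : ρ.IsHermitian) (a b : Fin n × Fin 2) :
    (covarianceEntry ρ a b).im = 0 := by
  rw [← Complex.conj_eq_iff_im]
  have h : (starRingEnd ℂ) (Matrix.trace (ρ * (majorana a * majorana b - majorana b * majorana a)))
      = -Matrix.trace (ρ * (majorana a * majorana b - majorana b * majorana a)) := by
    rw [starRingEnd_apply, ← Matrix.trace_conjTranspose, Matrix.conjTranspose_mul,
      Matrix.conjTranspose_sub, Matrix.conjTranspose_mul, Matrix.conjTranspose_mul,
      majorana_conjTranspose, majorana_conjTranspose, hρ.eq, Matrix.trace_mul_comm,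
      ← Matrix.trace_neg, ← mul_neg, neg_sub]
  rw [covarianceEntry, map_mul, h]
  simp [Complex.conj_ofNat]

end FAF

end

noncomputable section

namespace FAF

variable {n : ℕ}

/-! ### Trace distance of pure states -/

theorem density_eq_vecMulVec (ψ : State n) :
    density ψ = Matrix.vecMulVec ψ.ofLp (star ψ.ofLp) := by
  ext x y
  simp [density, Matrix.vecMulVec_apply]

theorem density_conjTranspose (ψ : State n) : (density ψ)ᴴ = density ψ := by
  ext x y
  simp [density, mul_comm]

theorem density_mul_density (ψ φ : State n) :
    density ψ * density φ = inner ℂ ψ φ • Matrix.vecMulVec ψ.ofLp (star φ.ofLp) := by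
  rw [density_eq_vecMulVec, density_eq_vecMulVec, Matrix.vecMulVec_mul_vecMulVec,
    Matrix.vecMulVec_smul, EuclideanSpace.inner_eq_star_dotProduct, dotProduct_comm]

theorem density_sandwich (ψ φ : State n) :
    density ψ * density φ * density ψ = ((‖inner ℂ ψ φ‖ ^ 2 : ℝ) : ℂ) • density ψ := by
  rw [density_mul_density, density_eq_vecMulVec ψ, Matrix.smul_mul,
    Matrix.vecMulVec_mul_vecMulVec, Matrix.vecMulVec_smul, smul_smul]
  congr 1
  have h : star φ.ofLp ⬝ᵥ ψ.ofLp = inner ℂ φ ψ := by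
    rw [EuclideanSpace.inner_eq_star_dotProduct, dotProduct_comm]
  rw [h, ← inner_conj_symm φ ψ, RCLike.mul_conj]
  norm_cast

theorem density_mul_self {ψ : State n} (hψ : ‖ψ‖ = 1) :
    density ψ * density ψ = density ψ := by
  rw [density_mul_density, inner_self_eq_norm_sq_to_K, hψ, density_eq_vecMulVec]
  simp

theorem trace_density_mul (ψ : State n) (M : Op n) :
    Matrix.trace (density ψ * M) = star ψ.ofLp ⬝ᵥ M.mulVec ψ.ofLp := by
  rw [density_eq_vecMulVec, Matrix.vecMulVec_mul, Matrix.trace_vecMulVec, dotProduct_comm,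
    Matrix.dotProduct_mulVec]

theorem trace_density {ψ : State n} (hψ : ‖ψ‖ = 1) : Matrix.trace (density ψ) = 1 := by
  rw [density_eq_vecMulVec, Matrix.trace_vecMulVec, ← EuclideanSpace.inner_eq_star_dotProduct,
    inner_self_eq_norm_sq_to_K, hψ]
  simp

theorem traceNorm_eq_of_cube {A : Op n} (hA : Aᴴ = A) {t : ℝ} (ht : 0 ≤ t)
    (hcube : A * A * A = ((t ^ 2 : ℝ) : ℂ) • A)
    (htr : Matrix.trace (A * A) = ((2 * t ^ 2 : ℝ) : ℂ)) : traceNorm A = 2 * t := by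
  have hH := Matrix.isHermitian_conjTranspose_mul_self A
  have hM : (Aᴴ * A) * (Aᴴ * A) = ((t ^ 2 : ℝ) : ℂ) • (Aᴴ * A) := by
    rw [hA, ← mul_assoc, hcube, Matrix.smul_mul]
  have hroot : ∀ i, √(hH.eigenvalues i) * t = hH.eigenvalues i ∧
      (t = 0 → √(hH.eigenvalues i) = 0) := by
    intro i
    have hv := hH.mulVec_eigenvectorBasis i
    set v := hH.eigenvectorBasis i with hvdef
    set μ := hH.eigenvalues i with hμ
    have hv0 : v.ofLp ≠ 0 := by
      intro h
      have h1 : ‖v‖ = 1 := hH.eigenvectorBasis.orthonormal.1 i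
      have h2 : v = 0 := by ext j; simpa using congrFun h j
      simp [h2] at h1
    have h1 : ((Aᴴ * A) * (Aᴴ * A)).mulVec v.ofLp = (μ * μ) • v.ofLp := by
      rw [← Matrix.mulVec_mulVec, hv, Matrix.mulVec_smul, hv, smul_smul]
    have h2 : ((Aᴴ * A) * (Aᴴ * A)).mulVec v.ofLp = (t ^ 2 * μ) • v.ofLp := by
      rw [hM, Matrix.smul_mulVec, hv, mul_smul]
      ext j; simp
    have h3 : μ * μ = t ^ 2 * μ := smul_left_injective ℝ hv0 (h1.symm.trans h2)
    rcases eq_or_ne μ 0 with h0 | h0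
    · simp [h0]
    · have h4 : μ = t ^ 2 := mul_right_cancel₀ h0 h3
      rw [h4, Real.sqrt_sq ht]
      exact ⟨by ring, id⟩
  have hsum : traceNorm A * t = 2 * t ^ 2 := by
    have h := hH.trace_eq_sum_eigenvalues
    replace h := (congrArg (fun B => Matrix.trace (B * A)) hA).symm.trans h
    rw [htr] at h
    have h' : 2 * t ^ 2 = ∑ i, hH.eigenvalues i :=
      Complex.ofReal_injective (h.trans (by rw [Complex.ofReal_sum]; rfl))
    rw [h', traceNorm, Finset.sum_mul]
    exact Finset.sum_congr rfl fun i _ => (hroot i).1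
  rcases eq_or_ne t 0 with h0 | h0
  · rw [traceNorm, Finset.sum_eq_zero fun i _ => (hroot i).2 h0, h0, mul_zero]
  · exact mul_right_cancel₀ h0 (by rw [hsum]; ring)

theorem traceDist_density {ψ φ : State n} (hψ : ‖ψ‖ = 1) (hφ : ‖φ‖ = 1) :
    traceDist (density ψ) (density φ) = √(1 - ‖inner ℂ ψ φ‖ ^ 2) := by
  have hk : ‖inner ℂ ψ φ‖ ^ 2 ≤ 1 := by
    have h := norm_inner_le_norm (𝕜 := ℂ) ψ φ
    rw [hψ, hφ, mul_one] at h
    exact pow_le_one₀ (norm_nonneg _) h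
  have hP := density_mul_self hψ
  have hQ := density_mul_self hφ
  have hPQP := density_sandwich ψ φ
  have hQPQ := density_sandwich φ ψ
  rw [norm_inner_symm φ ψ] at hQPQ
  have htr : Matrix.trace (density ψ * density φ) = ((‖inner ℂ ψ φ‖ ^ 2 : ℝ) : ℂ) := by
    have h := congrArg Matrix.trace hPQP
    rwa [Matrix.trace_mul_comm, ← mul_assoc, hP, Matrix.trace_smul, trace_density hψ,
      smul_eq_mul, mul_one] at h
  have hsq : (density ψ - density φ) * (density ψ - density φ)
      = density ψ + density φ - density ψ * density φ - density φ * density ψ := by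
    rw [mul_sub, sub_mul, sub_mul, hP, hQ]
    abel
  rw [traceDist, traceNorm_eq_of_cube (t := √(1 - ‖inner ℂ ψ φ‖ ^ 2)) _ (Real.sqrt_nonneg _)]
  · ring
  · rw [Real.sq_sqrt (by linarith), hsq]
    push_cast at hPQP hQPQ ⊢
    have e1 : density φ * density ψ * density ψ = density φ * density ψ := by
      rw [mul_assoc, hP]
    have e2 : density ψ * density φ * density φ = density ψ * density φ := by
      rw [mul_assoc, hQ]
    simp only [sub_mul, mul_sub, add_mul, hP, hQ, hPQP, hQPQ, e1, e2]
    module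
  · rw [Real.sq_sqrt (by linarith), hsq, Matrix.trace_sub, Matrix.trace_sub, Matrix.trace_add,
      trace_density hψ, trace_density hφ, Matrix.trace_mul_comm (density φ), htr]
    push_cast
    ring
  · rw [Matrix.conjTranspose_sub, density_conjTranspose, density_conjTranspose]

/-! ### Majorana operators -/

theorem tensorOp_mul (A B : Fin n → Matrix (Fin 2) (Fin 2) ℂ) :
    tensorOp A * tensorOp B = tensorOp fun k => A k * B k := by
  ext x y
  simp only [tensorOp, Matrix.mul_apply, Matrix.of_apply, ← Finset.prod_mul_distrib]
  rw [Finset.prod_univ_sum, Fintype.piFinset_univ]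

theorem tensorOp_one : tensorOp (fun _ : Fin n => 1) = 1 := by
  ext x y
  simp only [tensorOp, Matrix.of_apply, Matrix.one_apply, Finset.prod_ite_zero, funext_iff]
  simp

theorem tensorOp_eq_neg {A B : Fin n → Matrix (Fin 2) (Fin 2) ℂ} (j : Fin n)
    (hj : A j = -B j) (h : ∀ k, k ≠ j → A k = B k) : tensorOp A = -tensorOp B := by
  ext x y
  simp only [tensorOp, Matrix.of_apply, Matrix.neg_apply]
  rw [← Finset.mul_prod_erase _ _ (Finset.mem_univ j),
    ← Finset.mul_prod_erase (Finset.univ) (fun k => B k (x k) (y k)) (Finset.mem_univ j), hj,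
    Finset.prod_congr rfl fun k hk => by rw [h k (Finset.ne_of_mem_erase hk)]]
  simp

theorem pauliX_mul_self : pauliX * pauliX = 1 := by
  ext i j; fin_cases i <;> fin_cases j <;> simp [pauliX, Matrix.mul_apply]

theorem pauliY_mul_self : pauliY * pauliY = 1 := by
  ext i j; fin_cases i <;> fin_cases j <;> simp [pauliY, Matrix.mul_apply]

theorem pauliZ_mul_self : pauliZ * pauliZ = 1 := by
  ext i j; fin_cases i <;> fin_cases j <;> simp [pauliZ, Matrix.mul_apply]

theorem pauliX_mul_pauliY : pauliX * pauliY = -(pauliY * pauliX) := by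
  ext i j; fin_cases i <;> fin_cases j <;> simp [pauliX, pauliY, Matrix.mul_apply]

theorem pauliX_mul_pauliZ : pauliX * pauliZ = -(pauliZ * pauliX) := by
  ext i j; fin_cases i <;> fin_cases j <;> simp [pauliX, pauliZ, Matrix.mul_apply]

theorem pauliY_mul_pauliZ : pauliY * pauliZ = -(pauliZ * pauliY) := by
  ext i j; fin_cases i <;> fin_cases j <;> simp [pauliY, pauliZ, Matrix.mul_apply]

theorem majorana_mul_self (a : Fin n × Fin 2) : majorana a * majorana a = 1 := by
  rw [majorana, tensorOp_mul, ← tensorOp_one]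
  congr 1
  funext k
  split_ifs <;> simp [pauliX_mul_self, pauliY_mul_self, pauliZ_mul_self]

theorem majorana_anticomm {a b : Fin n × Fin 2} (hab : a ≠ b) :
    majorana a * majorana b = -(majorana b * majorana a) := by
  wlog h : a.1 ≤ b.1 generalizing a b
  · rw [this hab.symm (le_of_not_ge h), neg_neg]
  obtain ⟨i, c⟩ := a
  obtain ⟨j, d⟩ := b
  simp only [majorana, tensorOp_mul]
  refine tensorOp_eq_neg i ?_ fun k hk => ?_
  · rcases eq_or_lt_of_le h with h | h
    · have h : i = j := h
      subst h
      fin_cases c <;> fin_cases d <;> simp_all [pauliX_mul_pauliY]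
    · have h : i < j := h
      simp only [lt_irrefl, if_false, if_true, h]
      split_ifs <;> simp [pauliX_mul_pauliZ, pauliY_mul_pauliZ]
  · simp only [hk, if_false]
    have hlt : k < i → k < j := fun h' => h'.trans_le h
    split_ifs <;> first | simp | exact absurd (hlt ‹_›) ‹_›

/-- The occupation string `x` with the `j`-th bit flipped. -/
def flip (j : Fin n) (x : Fin n → Fin 2) : Fin n → Fin 2 := x + Pi.single j 1

theorem fin_two_add_self (s : Fin 2) : s + s = 0 := by fin_cases s <;> rfl

theorem flip_flip (j : Fin n) (x : Fin n → Fin 2) : flip j (flip j x) = x := by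
  funext k
  simp [flip, add_assoc, fin_two_add_self]

/-- The phase of the nonzero entry of a Majorana operator in row `x`. -/
def phase (a : Fin n × Fin 2) (x : Fin n → Fin 2) : ℂ :=
  (∏ k, if k < a.1 then (if x k = 0 then 1 else -1) else 1) *
    if a.2 = 0 then 1 else if x a.1 = 0 then -Complex.I else Complex.I

theorem norm_phase_zero (j : Fin n) (x : Fin n → Fin 2) :
    ‖phase (j, 0) x‖ = 1 := by
  simp only [phase, norm_mul, norm_prod]
  rw [Finset.prod_eq_one]
  · simp
  · intro k _
    split_ifs <;> simp

theorem phase_one (j : Fin n) (x : Fin n → Fin 2) :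
    phase (j, 1) x = phase (j, 0) x * if x j = 0 then -Complex.I else Complex.I := by
  simp [phase]

theorem majorana_apply (a : Fin n × Fin 2) (x y : Fin n → Fin 2) :
    majorana a x y = if y = flip a.1 x then phase a x else 0 := by
  obtain ⟨j, c⟩ := a
  simp only [majorana, tensorOp, Matrix.of_apply]
  by_cases h : y = flip j x
  · rw [if_pos h]
    subst h
    rw [phase, ← Finset.mul_prod_erase _ _ (Finset.mem_univ j),
      ← Finset.mul_prod_erase Finset.univ (fun k => if k < j then _ else _) (Finset.mem_univ j)]
    simp only [lt_irrefl, if_false, if_true, one_mul]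
    rw [mul_comm]
    congr 1
    · refine Finset.prod_congr rfl fun k hk => ?_
      have hk := Finset.ne_of_mem_erase hk
      simp only [hk, if_false, flip, Pi.add_apply, Pi.single_eq_of_ne hk, add_zero]
      generalize x k = s
      split_ifs <;> fin_cases s <;> simp_all [pauliZ]
    · simp only [flip, Pi.add_apply, Pi.single_eq_same]
      generalize x j = s
      fin_cases c <;> fin_cases s <;> simp [pauliX, pauliY]
  · rw [if_neg h]
    obtain ⟨k, hk⟩ := Function.ne_iff.1 h
    refine Finset.prod_eq_zero (Finset.mem_univ k) ?_
    by_cases hkj : k = j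
    · subst hkj
      simp only [flip, Pi.add_apply, Pi.single_eq_same] at hk
      simp only [lt_irrefl, if_false, if_true]
      generalize x k = s at *
      generalize y k = t at *
      fin_cases c <;> fin_cases s <;> fin_cases t <;> simp_all [pauliX, pauliY]
    · simp only [flip, Pi.add_apply, Pi.single_eq_of_ne hkj, add_zero] at hk
      simp only [hkj, if_false]
      generalize x k = s at *
      generalize y k = t at *
      split_ifs <;> fin_cases s <;> fin_cases t <;> simp_all [pauliZ]

theorem majorana_mulVec (a : Fin n × Fin 2) (v : (Fin n → Fin 2) → ℂ) (x : Fin n → Fin 2) :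
    (majorana a).mulVec v x = phase a x * v (flip a.1 x) := by
  simp [Matrix.mulVec, dotProduct, majorana_apply]

/-! ### Covariance as a Gram matrix -/

theorem majorana_gram (ψ : State n) (a b : Fin n × Fin 2) :
    star ((majorana a).mulVec ψ.ofLp) ⬝ᵥ (majorana b).mulVec ψ.ofLp
      = Matrix.trace (density ψ * (majorana a * majorana b)) := by
  rw [trace_density_mul, Matrix.star_mulVec, majorana_conjTranspose, ← Matrix.mulVec_mulVec,
    Matrix.dotProduct_mulVec, Matrix.dotProduct_mulVec]
  simp [Matrix.dotProduct_mulVec]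

theorem covariance_coe (ψ : State n) (a b : Fin n × Fin 2) :
    ((covariance (density ψ) a b : ℝ) : ℂ) = covarianceEntry (density ψ) a b := by
  refine Complex.ext rfl ?_
  rw [covarianceEntry_im (density_conjTranspose ψ)]
  simp

theorem covariance_self (ψ : State n) (a : Fin n × Fin 2) : covariance (density ψ) a a = 0 := by
  simp [covariance, covarianceEntry]

theorem covariance_of_ne (ψ : State n) {a b : Fin n × Fin 2} (hab : a ≠ b) :
    ((covariance (density ψ) a b : ℝ) : ℂ) =
      -Complex.I * (star ((majorana a).mulVec ψ.ofLp) ⬝ᵥ (majorana b).mulVec ψ.ofLp) := by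
  rw [covariance_coe, majorana_gram, covarianceEntry, majorana_anticomm hab.symm, sub_neg_eq_add,
    mul_add, Matrix.trace_add]
  ring

theorem covariance_swap (ψ : State n) (a b : Fin n × Fin 2) :
    covariance (density ψ) b a = -covariance (density ψ) a b := by
  have h : covarianceEntry (density ψ) b a = -covarianceEntry (density ψ) a b := by
    simp only [covarianceEntry]
    rw [← neg_sub (majorana a * majorana b), mul_neg, Matrix.trace_neg, mul_neg]
  simp [covariance, h]

theorem gram_eq {ψ : State n} (hψ : ‖ψ‖ = 1) (a b : Fin n × Fin 2) :
    star ((majorana a).mulVec ψ.ofLp) ⬝ᵥ (majorana b).mulVec ψ.ofLp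
      = (if a = b then 1 else 0) + Complex.I * (covariance (density ψ) a b : ℝ) := by
  split_ifs with h
  · subst h
    rw [majorana_gram, majorana_mul_self, mul_one, trace_density hψ, covariance_self]
    simp
  · rw [covariance_of_ne ψ h, ← mul_assoc]
    simp

/-- On a pure Gaussian state, `γ_a` acts as `-i ∑_b Γ_{ab} γ_b`. -/
theorem majorana_mulVec_of_gaussian {φ : State n} (hφ : φ ∈ pureGaussian n) (a : Fin n × Fin 2) :
    (majorana a).mulVec φ.ofLp =
      -∑ b, (Complex.I * (covariance (density φ) a b : ℝ)) • (majorana b).mulVec φ.ofLp := by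
  set Γ := covariance (density φ) with hΓ
  set v := fun b => (majorana b).mulVec φ.ofLp with hv
  have hsq : ∀ c, ∑ b, (Γ a b : ℂ) * Γ c b = if c = a then 1 else 0 := by
    intro c
    have h := congrFun (congrFun hφ.2 a) c
    rw [pow_two, Matrix.mul_apply, Matrix.neg_apply, Matrix.one_apply] at h
    have h' : ∑ b, Γ a b * Γ c b = if c = a then 1 else 0 := by
      rw [← neg_inj, ← Finset.sum_neg_distrib]
      simp only [eq_comm (a := c), ← h, ← mul_neg]
      exact Finset.sum_congr rfl fun b _ => by rw [hΓ, covariance_swap φ c b]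
    have h'' := congrArg (fun r : ℝ => (r : ℂ)) h'
    push_cast at h''
    rw [h'']
    split_ifs <;> simp
  set u := v a + ∑ b, (Complex.I * (Γ a b : ℂ)) • v b with hu
  have horth : ∀ c, star (v c) ⬝ᵥ u = 0 := by
    intro c
    have hca : (Γ c a : ℂ) = -Γ a c := by rw [hΓ, covariance_swap φ a c]; push_cast; ring
    simp only [hu, dotProduct_add, dotProduct_sum, dotProduct_smul, hv, gram_eq hφ.1, smul_eq_mul]
    have hI : ∀ b, Complex.I * (Γ a b : ℂ) * ((if c = b then 1 else 0) + Complex.I * (Γ c b : ℂ))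
        = (if c = b then Complex.I * (Γ a b : ℂ) else 0) - (Γ a b : ℂ) * Γ c b := by
      intro b
      split_ifs <;> linear_combination (Γ a b : ℂ) * Γ c b * Complex.I_sq
    rw [Finset.sum_congr rfl fun b _ => hI b, Finset.sum_sub_distrib, hsq]
    simp only [← hΓ, hca, Finset.sum_ite_eq, Finset.mem_univ, if_true]
    ring
  have h0 : star u ⬝ᵥ u = 0 := by
    conv_lhs => enter [1]; rw [hu]
    simp [star_add, star_sum, add_dotProduct, sum_dotProduct, horth]
  have hu0 : u = 0 := by
    have h1 : inner ℂ (WithLp.toLp 2 u : State n) (WithLp.toLp 2 u) = 0 := by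
      rw [EuclideanSpace.inner_eq_star_dotProduct, dotProduct_comm]
      exact h0
    exact (WithLp.toLp_eq_zero 2).1 (inner_self_eq_zero.1 h1)
  exact eq_neg_of_add_eq_zero_left hu0

/-- The quadratic relations satisfied by the amplitudes of a pure Gaussian state. -/
theorem sum_majorana_mul_majorana_of_gaussian {φ : State n} (hφ : φ ∈ pureGaussian n)
    (x y : Fin n → Fin 2) :
    ∑ a, (majorana a).mulVec φ.ofLp x * (majorana a).mulVec φ.ofLp y = 0 := by
  set Γ := covariance (density φ) with hΓ
  set v := fun b => (majorana b).mulVec φ.ofLp with hv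
  have hsq : ∀ b c, ∑ a, (Γ a b : ℂ) * Γ a c = if b = c then 1 else 0 := by
    intro b c
    have h := congrFun (congrFun hφ.2 b) c
    rw [pow_two, Matrix.mul_apply, Matrix.neg_apply, Matrix.one_apply] at h
    have h' : ∑ a, Γ a b * Γ a c = if b = c then 1 else 0 := by
      rw [← neg_inj, ← Finset.sum_neg_distrib]
      simp only [← h, ← neg_mul]
      exact Finset.sum_congr rfl fun a _ => by rw [hΓ, covariance_swap φ a b]
    have h'' := congrArg (fun r : ℝ => (r : ℂ)) h'
    push_cast at h''
    rw [h'']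
    split_ifs <;> simp
  have hva : ∀ a z, v a z = -(Complex.I * ∑ b, (Γ a b : ℂ) * v b z) := by
    intro a z
    have h := congrFun (majorana_mulVec_of_gaussian hφ a) z
    simpa [Finset.sum_apply, mul_assoc, Finset.mul_sum] using h
  have key : ∑ a, v a x * v a y = -∑ a, v a x * v a y := by
    calc ∑ a, v a x * v a y
        = ∑ a, -∑ b, ∑ c, ((Γ a b : ℂ) * Γ a c) * (v b x * v c y) := by
          refine Finset.sum_congr rfl fun a _ => ?_
          have hI : ∀ p q : ℂ, -(Complex.I * p) * -(Complex.I * q) = -(p * q) := fun p q => by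
            linear_combination p * q * Complex.I_sq
          rw [hva a x, hva a y, hI, Finset.sum_mul_sum]
          simp only [neg_inj]
          exact Finset.sum_congr rfl fun b _ => Finset.sum_congr rfl fun c _ => by ring
      _ = -∑ b, ∑ c, (∑ a, (Γ a b : ℂ) * Γ a c) * (v b x * v c y) := by
          rw [Finset.sum_neg_distrib, Finset.sum_comm]
          congr 1
          refine Finset.sum_congr rfl fun b _ => ?_
          rw [Finset.sum_comm]
          simp only [Finset.sum_mul]
      _ = -∑ a, v a x * v a y := by simp [hsq]
  exact self_eq_neg.1 key

/-- The quadratic relations, with the Majorana operators written out on amplitudes. -/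
theorem sum_flip_mul_flip_of_gaussian {φ : State n} (hφ : φ ∈ pureGaussian n)
    (x y : Fin n → Fin 2) :
    ∑ j, (if x j = y j then 0 else
      phase (j, 0) x * phase (j, 0) y * (φ (flip j x) * φ (flip j y))) = 0 := by
  have h := sum_majorana_mul_majorana_of_gaussian hφ x y
  simp only [Fintype.sum_prod_type, Fin.sum_univ_two, majorana_mulVec, phase_one] at h
  have h2 : (2 : ℂ) * ∑ j, (if x j = y j then 0 else
      phase (j, 0) x * phase (j, 0) y * (φ (flip j x) * φ (flip j y))) = 0 := by
    refine Eq.trans ?_ h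
    rw [Finset.mul_sum]
    refine Finset.sum_congr rfl fun j _ => ?_
    clear h
    generalize phase (j, 0) x = p
    generalize phase (j, 0) y = q
    generalize φ (flip j x) = f
    generalize φ (flip j y) = g
    generalize x j = s
    generalize y j = t
    fin_cases s <;> fin_cases t <;> simp <;>
      first
        | linear_combination -p * q * f * g * Complex.I_sq
        | linear_combination p * q * f * g * Complex.I_sq
  exact (mul_eq_zero.1 h2).resolve_left two_ne_zero

/-! ### Amplitudes of pure Gaussian states -/

/-- The support of an occupation string. -/
def supp (s : Fin n → Fin 2) : Finset (Fin n) := Finset.univ.filter fun j => s j ≠ 0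

theorem mem_supp {s : Fin n → Fin 2} {j : Fin n} : j ∈ supp s ↔ s j ≠ 0 := by simp [supp]

theorem single_add_single_ne {s : Fin n → Fin 2} (hs : 3 ≤ (supp s).card) (j k : Fin n) :
    (Pi.single j 1 + Pi.single k 1 : Fin n → Fin 2) ≠ s := by
  rintro h
  have hsub : supp s ⊆ {j, k} := by
    intro i hi
    by_contra hjk
    simp only [Finset.mem_insert, Finset.mem_singleton, not_or] at hjk
    refine mem_supp.1 hi ?_
    rw [← h]
    simp [Pi.single_eq_of_ne hjk.1, Pi.single_eq_of_ne hjk.2]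
  have := (Finset.card_le_card hsub).trans Finset.card_le_two
  omega

theorem single_injective {j k : Fin n} (h : (Pi.single j 1 : Fin n → Fin 2) = Pi.single k 1) :
    j = k := by
  by_contra hne
  have := congrFun h j
  simp [Pi.single_eq_of_ne hne] at this

theorem sum_normSq_le {φ : State n} (hφ : ‖φ‖ = 1) {s : Fin n → Fin 2}
    (hs : 3 ≤ (supp s).card) (i : Fin n) :
    ∑ j ∈ supp s, (‖φ (flip j (Pi.single i 1))‖ ^ 2 + ‖φ (flip j (s + Pi.single i 1))‖ ^ 2) ≤ 1 := by
  have h1 : ∑ x, ‖φ x‖ ^ 2 = 1 := by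
    rw [← EuclideanSpace.norm_sq_eq, hφ, one_pow]
  have hdisj : Disjoint ((supp s).image fun j => flip j (Pi.single i 1))
      ((supp s).image fun j => flip j (s + Pi.single i 1)) := by
    rw [Finset.disjoint_left]
    rintro x hx hy
    obtain ⟨j, -, rfl⟩ := Finset.mem_image.1 hx
    obtain ⟨k, -, hk⟩ := Finset.mem_image.1 hy
    refine single_add_single_ne hs j k ?_
    simp only [flip] at hk
    have h2 : s + Pi.single k 1 = Pi.single j 1 := by
      apply add_left_cancel (a := (Pi.single i 1 : Fin n → Fin 2))
      rw [← hk]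
      abel
    rw [← h2, add_assoc]
    funext l
    simp [fin_two_add_self]
  have hinj : ∀ y : Fin n → Fin 2, Set.InjOn (fun j => flip j y) (supp s) :=
    fun y j _ k _ h => single_injective (add_left_cancel h)
  rw [Finset.sum_add_distrib, ← Finset.sum_image (f := fun x => ‖φ x‖ ^ 2) (hinj _),
    ← Finset.sum_image (f := fun x => ‖φ x‖ ^ 2) (hinj _), ← Finset.sum_union hdisj, ← h1]
  exact Finset.sum_le_sum_of_subset_of_nonneg (Finset.subset_univ _) fun _ _ _ => sq_nonneg _

/-- Two amplitudes of a pure Gaussian state at Hamming distance at least three. -/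
theorem norm_add_norm_le_one {φ : State n} (hφ : φ ∈ pureGaussian n) {s : Fin n → Fin 2}
    (hs : 3 ≤ (supp s).card) : ‖φ fun _ => 0‖ + ‖φ s‖ ≤ 1 := by
  obtain ⟨i, hi⟩ : (supp s).Nonempty := Finset.card_pos.1 (by omega)
  have hle := sum_normSq_le hφ.1 hs i
  have hrel := sum_flip_mul_flip_of_gaussian hφ (Pi.single i 1) (s + Pi.single i 1)
  set f : Fin n → ℂ := fun j => φ (flip j (Pi.single i 1)) with hf
  set g : Fin n → ℂ := fun j => φ (flip j (s + Pi.single i 1)) with hg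
  set p := fun j => phase (j, 0) (Pi.single i 1) * phase (j, 0) (s + Pi.single i 1) with hp
  have hfi : f i = φ fun _ => 0 := by
    refine congrArg φ.ofLp (funext fun k => ?_)
    simp [flip, fin_two_add_self]
  have hgi : g i = φ s := congrArg φ.ofLp (flip_flip i s)
  have hnp : ∀ j, ‖p j‖ = 1 := fun j => by simp [hp, norm_phase_zero]
  have hrel' : ∑ j ∈ supp s, p j * (f j * g j) = 0 := by
    rw [← hrel, supp, Finset.sum_filter]
    refine Finset.sum_congr rfl fun j _ => ?_
    have : (Pi.single i 1 : Fin n → Fin 2) j = (s + Pi.single i 1 : Fin n → Fin 2) j ↔ s j = 0 := by simp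
    by_cases h : s j = 0
    · rw [if_neg (not_not.2 h), if_pos (this.2 h)]
    · rw [if_pos h, if_neg (mt this.1 h)]
  rw [← Finset.add_sum_erase _ _ hi] at hrel' hle
  have hbound : ‖f i‖ * ‖g i‖ ≤ ∑ j ∈ (supp s).erase i, ‖f j‖ * ‖g j‖ := by
    have h1 : ‖p i * (f i * g i)‖ = ‖f i‖ * ‖g i‖ := by rw [norm_mul, hnp, one_mul, norm_mul]
    rw [← h1, eq_neg_of_add_eq_zero_left hrel', norm_neg]
    refine (norm_sum_le _ _).trans_eq (Finset.sum_congr rfl fun j _ => ?_)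
    rw [norm_mul, hnp, one_mul, norm_mul]
  have h2 : 2 * ∑ j ∈ (supp s).erase i, ‖f j‖ * ‖g j‖
      ≤ ∑ j ∈ (supp s).erase i, (‖f j‖ ^ 2 + ‖g j‖ ^ 2) := by
    rw [Finset.mul_sum]
    refine Finset.sum_le_sum fun j _ => ?_
    rw [← mul_assoc]
    exact two_mul_le_add_sq _ _
  have hle' : (‖f i‖ ^ 2 + ‖g i‖ ^ 2)
      + ∑ j ∈ (supp s).erase i, (‖f j‖ ^ 2 + ‖g j‖ ^ 2) ≤ 1 := hle
  rw [← hfi, ← hgi]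
  refine abs_le_one_iff_mul_self_le_one.2 ?_ |> (le_abs_self _).trans
  nlinarith

/-! ### Covariance of superpositions of distant occupation strings -/

/-- The expectation value of `Z_j`. -/
def zExpect (ψ : State n) (j : Fin n) : ℝ := ∑ x, ‖ψ x‖ ^ 2 * if x j = 0 then 1 else -1

theorem covariance_same_mode (ψ : State n) (j : Fin n) :
    covariance (density ψ) (j, 0) (j, 1) = zExpect ψ j := by
  apply Complex.ofReal_injective
  rw [covariance_of_ne ψ (by simp), zExpect, ← Equiv.sum_comp (Equiv.addRight (Pi.single j 1))]
  push_cast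
  simp only [dotProduct, Finset.mul_sum, Pi.star_apply, majorana_mulVec, phase_one]
  refine Finset.sum_congr rfl fun x _ => ?_
  change _ = (‖ψ (flip j x)‖ : ℂ) ^ 2 * _
  have hph : star (phase (j, 0) x) * phase (j, 0) x = 1 := by
    have h := RCLike.conj_mul (phase (j, 0) x)
    rw [norm_phase_zero] at h
    simpa using h
  have hps : star (ψ (flip j x)) * ψ (flip j x) = (‖ψ (flip j x)‖ : ℂ) ^ 2 :=
    RCLike.conj_mul (ψ (flip j x))
  rw [star_mul', ← hps]
  simp only [Equiv.coe_addRight, Pi.add_apply, Pi.single_eq_same]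
  generalize x j = t
  generalize ψ.ofLp (flip j x) = q at *
  generalize phase (j, 0) x = r at *
  fin_cases t <;> simp at hph ⊢
  · linear_combination Complex.I ^ 2 * (starRingEnd ℂ) q * q * hph
      + (starRingEnd ℂ) q * q * Complex.I_sq
  · linear_combination -Complex.I ^ 2 * (starRingEnd ℂ) q * q * hph
      - (starRingEnd ℂ) q * q * Complex.I_sq

theorem covariance_of_distant {ψ : State n}
    (hψ : ∀ j k, j ≠ k → ∀ x, ψ (flip j x) = 0 ∨ ψ (flip k x) = 0) (a b : Fin n × Fin 2) :
    covariance (density ψ) a b =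
      if a.1 = b.1 then zExpect ψ a.1 * (!![0, 1; -1, 0] : Matrix (Fin 2) (Fin 2) ℝ) a.2 b.2
      else 0 := by
  obtain ⟨j, c⟩ := a
  obtain ⟨k, d⟩ := b
  by_cases h : j = k
  · subst h
    rw [if_pos rfl]
    fin_cases c <;> fin_cases d
    · simpa using covariance_self ψ _
    · simpa using covariance_same_mode ψ j
    · simpa [covariance_same_mode] using covariance_swap ψ (j, 0) (j, 1)
    · simpa using covariance_self ψ _
  · rw [if_neg h]
    apply Complex.ofReal_injective
    rw [covariance_of_ne ψ (by simp [h]), dotProduct, Finset.sum_eq_zero]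
    · simp
    · intro x _
      simp only [Pi.star_apply, majorana_mulVec]
      rcases hψ j k h x with h | h <;> simp [h]

theorem covariance_sq_of_distant {ψ : State n}
    (hψ : ∀ j k, j ≠ k → ∀ x, ψ (flip j x) = 0 ∨ ψ (flip k x) = 0) :
    covariance (density ψ) ^ 2 = -Matrix.diagonal fun a => zExpect ψ a.1 ^ 2 := by
  ext ⟨j, c⟩ ⟨k, d⟩
  rw [pow_two, Matrix.mul_apply, Matrix.neg_apply, Matrix.diagonal_apply]
  simp only [covariance_of_distant hψ, Fintype.sum_prod_type, ite_mul, zero_mul]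
  rw [Finset.sum_eq_single j (by intro i _ hi; simp [hi.symm]) (by simp)]
  by_cases h : j = k
  · subst h
    fin_cases c <;> fin_cases d <;> simp [pow_two]
  · simp [h]

theorem faf_one_of_distant {ψ : State n}
    (hψ : ∀ j k, j ≠ k → ∀ x, ψ (flip j x) = 0 ∨ ψ (flip k x) = 0) :
    faf 1 (density ψ) = ∑ j, (1 - zExpect ψ j ^ 2) := by
  rw [faf, pow_one, covariance_sq_of_distant hψ, neg_neg, Matrix.trace_diagonal,
    Fintype.sum_prod_type]
  simp [← Finset.mul_sum]

/-! ### Superpositions of the vacuum and a distant occupation string -/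

/-- The superposition `a |0…0⟩ + b |s⟩`. -/
def twoKet (a b : ℝ) (s : Fin n → Fin 2) : State n :=
  (a : ℂ) • ket (fun _ => 0) + (b : ℂ) • ket s

theorem twoKet_apply (a b : ℝ) (s x : Fin n → Fin 2) :
    twoKet a b s x = (if x = (fun _ => 0) then (a : ℂ) else 0) + if x = s then (b : ℂ) else 0 := by
  simp [twoKet, ket]

theorem zero_ne_of_supp {s : Fin n → Fin 2} (hs : 3 ≤ (supp s).card) : (fun _ => 0) ≠ s := by
  rintro rfl
  simp [supp] at hs

theorem twoKet_distant (a b : ℝ) {s : Fin n → Fin 2} (hs : 3 ≤ (supp s).card) (j k : Fin n)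
    (hjk : j ≠ k) (x : Fin n → Fin 2) :
    twoKet a b s (flip j x) = 0 ∨ twoKet a b s (flip k x) = 0 := by
  have hadd : flip j x + flip k x = Pi.single j 1 + Pi.single k 1 := by
    simp only [flip]
    rw [add_add_add_comm]
    funext l
    simp [fin_two_add_self]
  have hne := single_add_single_ne hs j k
  have hself : ∀ u : Fin n → Fin 2, u + u = 0 := fun u => by
    funext l; simp [fin_two_add_self]
  have hinj : flip j x ≠ flip k x := fun h => hjk (single_injective (add_left_cancel h))
  have hz : (fun _ => 0 : Fin n → Fin 2) = 0 := rfl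
  rw [← hadd] at hne
  simp only [twoKet_apply, hz]
  generalize flip j x = u at *
  generalize flip k x = v at *
  by_cases h1 : u = 0 <;> by_cases h2 : u = s <;> by_cases h3 : v = 0 <;> by_cases h4 : v = s <;>
    simp_all

theorem sum_twoKet (a b : ℝ) {s : Fin n → Fin 2} (hs : 3 ≤ (supp s).card)
    (F : (Fin n → Fin 2) → ℝ) :
    ∑ x, ‖twoKet a b s x‖ ^ 2 * F x = a ^ 2 * F (fun _ => 0) + b ^ 2 * F s := by
  have h0 := zero_ne_of_supp hs
  have h : ∀ x, ‖twoKet a b s x‖ ^ 2 * F x = (if x = (fun _ => 0) then a ^ 2 * F x else 0)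
      + if x = s then b ^ 2 * F x else 0 := by
    intro x
    rw [twoKet_apply]
    split_ifs with h1 h2 h2
    · exact absurd (h1.symm.trans h2) h0
    all_goals simp
  simp [h, Finset.sum_add_distrib]

theorem norm_twoKet {a b : ℝ} (hab : a ^ 2 + b ^ 2 = 1) {s : Fin n → Fin 2}
    (hs : 3 ≤ (supp s).card) : ‖twoKet a b s‖ = 1 := by
  have h := sum_twoKet a b hs fun _ => 1
  simp only [mul_one, ← EuclideanSpace.norm_sq_eq, hab] at h
  exact (pow_eq_one_iff_of_nonneg (norm_nonneg _) two_ne_zero).1 h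

theorem zExpect_twoKet {a b : ℝ} (hab : a ^ 2 + b ^ 2 = 1) {s : Fin n → Fin 2}
    (hs : 3 ≤ (supp s).card) (j : Fin n) :
    zExpect (twoKet a b s) j = if j ∈ supp s then a ^ 2 - b ^ 2 else 1 := by
  rw [zExpect, sum_twoKet a b hs fun x => if x j = 0 then 1 else -1]
  by_cases h : s j = 0
  · simp [mem_supp, h, hab]
  · simp [mem_supp, h, sub_eq_add_neg]

theorem faf_twoKet {a b : ℝ} (hab : a ^ 2 + b ^ 2 = 1) {s : Fin n → Fin 2}
    (hs : 3 ≤ (supp s).card) :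
    faf 1 (density (twoKet a b s)) = (supp s).card * (4 * b ^ 2 * (1 - b ^ 2)) := by
  rw [faf_one_of_distant (twoKet_distant a b hs)]
  simp only [zExpect_twoKet hab hs]
  have h : ∀ j, 1 - (if j ∈ supp s then a ^ 2 - b ^ 2 else 1) ^ 2
      = if j ∈ supp s then 4 * b ^ 2 * (1 - b ^ 2) else 0 := by
    intro j
    split_ifs
    · rw [eq_sub_of_add_eq hab]; ring
    · ring
  simp only [h, Finset.sum_ite_mem, Finset.univ_inter, Finset.sum_const, nsmul_eq_mul]

theorem twoKet_one_zero_mem_pureGaussian {s : Fin n → Fin 2} (hs : 3 ≤ (supp s).card) :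
    twoKet 1 0 s ∈ pureGaussian n := by
  have hab : (1 : ℝ) ^ 2 + 0 ^ 2 = 1 := by norm_num
  refine ⟨norm_twoKet hab hs, ?_⟩
  rw [covariance_sq_of_distant (twoKet_distant 1 0 hs)]
  simp only [zExpect_twoKet hab hs]
  simp

theorem inner_twoKet (a b : ℝ) (s : Fin n → Fin 2) (φ : State n) :
    inner ℂ (twoKet a b s) φ = a * φ (fun _ => 0) + b * φ s := by
  simp [twoKet, ket, EuclideanSpace.inner_single_left]

theorem isLeast_gaussianDistances_twoKet {a b : ℝ} (hab : a ^ 2 + b ^ 2 = 1) (hb : 0 ≤ b)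
    (hba : b ≤ a) {s : Fin n → Fin 2} (hs : 3 ≤ (supp s).card) :
    IsLeast (gaussianDistances (twoKet a b s)) b := by
  have hnorm := norm_twoKet hab hs
  have hb2 : √(1 - a ^ 2) = b := by
    rw [← hab, add_sub_cancel_left, Real.sqrt_sq hb]
  constructor
  · have hG := twoKet_one_zero_mem_pureGaussian hs
    refine ⟨twoKet 1 0 s, hG, ?_⟩
    have h0 := zero_ne_of_supp hs
    simp only [traceDist_density hnorm hG.1, inner_twoKet, twoKet_apply, if_neg h0, if_neg h0.symm]
    simpa using hb2
  · rintro _ ⟨φ, hφ, rfl⟩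
    simp only [traceDist_density hnorm hφ.1, inner_twoKet]
    have hamp := norm_add_norm_le_one hφ hs
    have hle : ‖(a : ℂ) * φ (fun _ => 0) + b * φ s‖ ≤ a := by
      refine (norm_add_le _ _).trans ?_
      rw [norm_mul, norm_mul, Complex.norm_of_nonneg hb, Complex.norm_of_nonneg (hb.trans hba)]
      nlinarith [norm_nonneg (φ s), norm_nonneg (φ fun _ => 0)]
    refine hb2.symm.le.trans ?_
    exact Real.sqrt_le_sqrt (sub_le_sub_left (pow_le_pow_left₀ (norm_nonneg _) hle 2) 1)

theorem epsG_twoKet {a b : ℝ} (hab : a ^ 2 + b ^ 2 = 1) (hb : 0 ≤ b)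
    (hba : b ≤ a) {s : Fin n → Fin 2} (hs : 3 ≤ (supp s).card) : epsG (twoKet a b s) = b :=
  (isLeast_gaussianDistances_twoKet hab hb hba hs).csInf_eq

/-! ### The cat state and the localized defect -/

theorem card_supp_one : (supp fun _ : Fin n => (1 : Fin 2)).card = n := by simp [supp]

/-- The properties of the cat state that enter the tightness statements. -/
theorem catState_spec (hn : 3 ≤ n) {ε : ℝ} (hε : 0 ≤ ε) (hε2 : ε ^ 2 ≤ 1 / 2) :
    ‖catState n ε‖ = 1 ∧ IsLeast (gaussianDistances (catState n ε)) ε ∧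
      epsG (catState n ε) = ε ∧ faf 1 (density (catState n ε)) = 4 * n * ε ^ 2 * (1 - ε ^ 2) := by
  have hs : 3 ≤ (supp fun _ : Fin n => (1 : Fin 2)).card := by rwa [card_supp_one]
  have hab : √(1 - ε ^ 2) ^ 2 + ε ^ 2 = 1 := by rw [Real.sq_sqrt (by linarith)]; ring
  have hba : ε ≤ √(1 - ε ^ 2) := Real.le_sqrt_of_sq_le (by linarith)
  refine ⟨norm_twoKet hab hs, isLeast_gaussianDistances_twoKet hab hε hba hs,
    epsG_twoKet hab hε hba hs, (faf_twoKet hab hs).trans ?_⟩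
  rw [card_supp_one]
  ring

/-- The occupation string `1111 0…0`. -/
def defectString (m : ℕ) : Fin (4 + m) → Fin 2 := Fin.append (fun _ : Fin 4 => 1) fun _ => 0

theorem card_supp_defectString (m : ℕ) : (supp (defectString m)).card = 4 := by
  rw [supp, Finset.card_filter, Fin.sum_univ_add]
  simp [defectString]

theorem defectState_eq (m : ℕ) : defectState m = twoKet (1 / √2) (1 / √2) (defectString m) := by
  ext x
  have h1 : ∀ (c : Fin 2), x = Fin.append (fun _ : Fin 4 => c) (fun _ : Fin m => 0) ↔
      (fun i => x (Fin.castAdd m i)) = (fun _ => c) ∧ (fun j => x (Fin.natAdd 4 j)) = fun _ => 0 := by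
    intro c
    constructor
    · rintro rfl
      simp
    · rintro ⟨h, h'⟩
      funext i
      refine Fin.addCases (fun i => ?_) (fun i => ?_) i
      · simpa using congrFun h i
      · simpa using congrFun h' i
  have h0 : (fun _ => 0 : Fin (4 + m) → Fin 2) = Fin.append (fun _ : Fin 4 => 0) fun _ => 0 := by
    funext i
    refine Fin.addCases (fun i => ?_) (fun i => ?_) i <;> simp
  rw [twoKet_apply, h0, defectString]
  simp only [h1, defectState, tensorState, ket, PiLp.smul_apply, PiLp.add_apply,
    PiLp.single_apply, smul_eq_mul]
  split_ifs <;> simp_all [mul_add]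

/-- The properties of the localized defect that enter the tightness statements. -/
theorem defectState_spec (m : ℕ) :
    ‖defectState m‖ = 1 ∧ IsLeast (gaussianDistances (defectState m)) (1 / √2) ∧
      epsG (defectState m) = 1 / √2 ∧ faf 1 (density (defectState m)) = 4 := by
  have hs : 3 ≤ (supp (defectString m)).card := by rw [card_supp_defectString]; norm_num
  have hsq : (1 / √2 : ℝ) ^ 2 = 1 / 2 := by rw [div_pow, Real.sq_sqrt (by norm_num)]; norm_num
  have hab : (1 / √2 : ℝ) ^ 2 + (1 / √2) ^ 2 = 1 := by rw [hsq]; norm_num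
  have hb : (0 : ℝ) ≤ 1 / √2 := by positivity
  rw [defectState_eq]
  refine ⟨norm_twoKet hab hs, isLeast_gaussianDistances_twoKet hab hb le_rfl hs,
    epsG_twoKet hab hb le_rfl hs, (faf_twoKet hab hs).trans ?_⟩
  rw [card_supp_defectString, hsq]
  norm_num

theorem eventually_sq_le_half : ∀ᶠ ε : ℝ in 𝓝[>] 0, 0 < ε ∧ ε ^ 2 ≤ 1 / 2 := by
  filter_upwards [Ioo_mem_nhdsGT (show (0 : ℝ) < 1 / 2 by norm_num)] with ε hε
  exact ⟨hε.1, by nlinarith [hε.1, hε.2]⟩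

theorem tendsto_four_mul_one_sub_sq :
    Filter.Tendsto (fun ε : ℝ => 4 * (1 - ε ^ 2)) (𝓝[>] 0) (𝓝 4) := by
  have h : Filter.Tendsto (fun ε : ℝ => 4 * (1 - ε ^ 2)) (𝓝 0) (𝓝 (4 * (1 - 0 ^ 2))) :=
    Continuous.tendsto (by fun_prop) 0
  simpa using h.mono_left nhdsWithin_le_nhds

end FAF

end

theorem mainTheorem10 :
    -- the delocalized cat state
    (∀ n : ℕ, Even n → 4 ≤ n → ∀ ε : ℝ, 0 ≤ ε → ε ^ 2 ≤ 1 / 2 →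
      ‖FAF.catState n ε‖ = 1 ∧
      IsLeast (FAF.gaussianDistances (FAF.catState n ε)) (FAF.epsG (FAF.catState n ε)) ∧
      FAF.epsG (FAF.catState n ε) = ε ∧
      FAF.faf 1 (FAF.density (FAF.catState n ε)) = 4 * n * ε ^ 2 * (1 - ε ^ 2)) ∧
    -- essential tightness of the factor `1 / (4 n)`
    (∀ n : ℕ, Even n → 4 ≤ n →
      Filter.Tendsto
        (fun ε : ℝ => FAF.faf 1 (FAF.density (FAF.catState n ε)) /
          (n * FAF.epsG (FAF.catState n ε) ^ 2)) (𝓝[>] 0) (𝓝 4)) ∧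
    (∀ n : ℕ, Even n → 4 ≤ n → ∀ c : ℝ,
      (∀ ψ : FAF.State n, ‖ψ‖ = 1 →
        c / n * FAF.faf 1 (FAF.density ψ) ≤ FAF.epsG ψ ^ 2) → c ≤ 1 / 4) ∧
    (¬ ∃ c : ℝ, 0 < c ∧ ∀ n : ℕ, 0 < n → ∀ ψ : FAF.State n, ‖ψ‖ = 1 →
      c * FAF.faf 1 (FAF.density ψ) ≤ FAF.epsG ψ ^ 2) ∧
    -- the localized defect on `n = 4 + m` modes
    (∀ m : ℕ,
      ‖FAF.defectState m‖ = 1 ∧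
      IsLeast (FAF.gaussianDistances (FAF.defectState m)) (FAF.epsG (FAF.defectState m)) ∧
      FAF.faf 1 (FAF.density (FAF.defectState m)) = 4 ∧
      FAF.epsG (FAF.defectState m) ^ 2 = 1 / 2) ∧
    (¬ ∃ C : ℝ, ∀ n : ℕ, 0 < n → ∀ ψ : FAF.State n, ‖ψ‖ = 1 →
      FAF.epsG ψ ^ 2 ≤ C * FAF.faf 1 (FAF.density ψ) / n) := by
  have hsq : (1 / √2 : ℝ) ^ 2 = 1 / 2 := by rw [div_pow, Real.sq_sqrt (by norm_num)]; norm_num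
  refine ⟨?_, ?_, ?_, ?_, ?_, ?_⟩
  · intro n _ hn ε hε hε2
    obtain ⟨h1, h2, h3, h4⟩ := FAF.catState_spec (by omega : 3 ≤ n) hε hε2
    exact ⟨h1, h3.symm ▸ h2, h3, h4⟩
  · intro n _ hn
    refine FAF.tendsto_four_mul_one_sub_sq.congr' ?_
    filter_upwards [FAF.eventually_sq_le_half] with ε hε
    obtain ⟨-, -, h3, h4⟩ := FAF.catState_spec (by omega : 3 ≤ n) hε.1.le hε.2
    have hn0 : (n : ℝ) ≠ 0 := by positivity
    have hε0 := hε.1.ne'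
    rw [h3, h4]
    field_simp
  · intro n _ hn c hc
    have hle : c * 4 ≤ 1 := by
      refine le_of_tendsto (FAF.tendsto_four_mul_one_sub_sq.const_mul c) ?_
      filter_upwards [FAF.eventually_sq_le_half] with ε hε
      obtain ⟨h1, -, h3, h4⟩ := FAF.catState_spec (by omega : 3 ≤ n) hε.1.le hε.2
      have h := hc _ h1
      have hn0 : (n : ℝ) ≠ 0 := by positivity
      rw [h3, h4, show c / n * (4 * n * ε ^ 2 * (1 - ε ^ 2)) = c * (4 * (1 - ε ^ 2)) * ε ^ 2 by
        field_simp] at h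
      have hpos : 0 < ε ^ 2 := pow_pos hε.1 2
      exact le_of_mul_le_mul_right (by linarith) hpos
    linarith
  · rintro ⟨c, hc, h⟩
    obtain ⟨k, hk⟩ := exists_nat_gt (1 / c)
    have hε : (0 : ℝ) ≤ 1 / √2 := by positivity
    obtain ⟨h1, -, h3, h4⟩ := FAF.catState_spec (by omega : 3 ≤ k + 3) hε hsq.le
    have h' := h _ (by omega) _ h1
    rw [h3, h4, hsq] at h'
    rw [div_lt_iff₀ hc] at hk
    push_cast at h'
    nlinarith
  · intro m
    obtain ⟨h1, h2, h3, h4⟩ := FAF.defectState_spec m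
    exact ⟨h1, h3.symm ▸ h2, h4, by rw [h3, hsq]⟩
  · rintro ⟨C, hC⟩
    obtain ⟨m, hm⟩ := exists_nat_gt (8 * C)
    obtain ⟨h1, -, h3, h4⟩ := FAF.defectState_spec m
    have h := hC _ (by omega) _ h1
    rw [h3, h4, hsq, le_div_iff₀ (by positivity)] at h
    push_cast at h
    linarith
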